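/- For a finite group $G$ and $x\in G$, the subnormalizer of $x$ in $G$ is the subgroup $$\mathbf{Sub}_G(x)=\langle\, g\in G \mid \langle x\rangle \text{ is subnormal in } \langle x,g\rangle \,\rangle .$$ For $\Omega\subseteq\{1,\dots,n\}$ write $\mathsf S_\Omega=\operatorname{Sym}(\Omega)$ and $\overline\Omega=\{1,\dots,n\}\setminus\Omega$, and regard $\mathsf S_\Omega\times\mathsf S_{\overline\Omega}$ as a subgroup of $\mathsf S_n$. **Theorem.** Let $n$ be a non-negative integer that is not a power of $2$ (where $1=2^0$ counts as a power of $2$), and let $x\in\mathsf S_n$ be a $2$-element. Let the distinct lengths of the cycles of $x$ (fixed points being counted as cycles of length $1$) be $2^{m_1},\dots,2^{m_r}$ with $0\le m_1<m_2<\dots<m_r$, and suppose that $x$ has exactly $\ell_i\ge 1$ cycles of length $2^{m_i}$ for $1\le i\le r$. Then $\mathbf{Sub}_{\mathsf S_n}(x)<\mathsf S_n$ if and only if there exists $t$ with $2\le t\le r$ such that $$2^{m_t}>\sum_{i=1}^{t-1}\ell_i2^{m_i}.$$ Moreover, for every such $t$, let $y$ be the product of all cycles of $x$ of length at least $2^{m_t}$,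 let $z$ be the product of all cycles of $x$ of length smaller than $2^{m_t}$, and let $\Omega$ be the support of $y$ (the set of points moved by $y$). Then $|\Omega|=k:=\sum_{i=t}^{r}\ell_i2^{m_i}$, so that $\mathsf S_\Omega\cong\mathsf S_k$ and $\mathsf S_{\overline\Omega}\cong\mathsf S_{n-k}$, and $$\mathbf{Sub}_{\mathsf S_n}(x)=\mathbf{Sub}_{\mathsf S_\Omega}(y)\times\mathbf{Sub}_{\mathsf S_{\overline\Omega}}(z).$$ -/

import Mathlib

/-- The subnormalizer of `x` in `G`: the subgroup generated by all `g` such that `⟨x⟩` is subnormal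
in `⟨x, g⟩`. -/
def subnormalizer {G : Type*} [Group G] (x : G) : Subgroup G :=
  Subgroup.closure
    {g : G | ((Subgroup.zpowers x).subgroupOf (Subgroup.closure {x, g})).IsSubnormal}

namespace Equiv.Perm

variable {α : Type*} [DecidableEq α] [Fintype α]

/-- The product of all cycles of length at least `L` in the disjoint cycle decomposition of `x`.
(Cycles of length one are the identity and do not contribute.) -/
def longPart (x : Perm α) (L : ℕ) : Perm α :=
  (x.cycleFactorsFinset.filter fun c => L ≤ c.support.card).noncommProd id fun _ ha _ hb h =>
    x.cycleFactorsFinset_mem_commute (Finset.mem_filter.mp ha).1 (Finset.mem_filter.mp hb).1 h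

/-- The product of all cycles of length smaller than `L` in the disjoint cycle decomposition
of `x`. -/
def shortPart (x : Perm α) (L : ℕ) : Perm α :=
  (x.cycleFactorsFinset.filter fun c => c.support.card < L).noncommProd id fun _ ha _ hb h =>
    x.cycleFactorsFinset_mem_commute (Finset.mem_filter.mp ha).1 (Finset.mem_filter.mp hb).1 h

theorem disjoint_longPart_shortPart (x : Perm α) (L : ℕ) :
    (x.longPart L).Disjoint (x.shortPart L) := by
  unfold longPart shortPart
  apply disjoint_noncommProd_right
  intro c hc
  apply Disjoint.symm
  apply disjoint_noncommProd_right
  intro d hd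
  rw [Finset.mem_filter] at hc hd
  refine x.cycleFactorsFinset_pairwise_disjoint hc.1 hd.1 ?_
  rintro rfl
  exact absurd hc.2 (not_lt.mpr hd.2)

theorem shortPart_apply_notMem_support_longPart_iff (x : Perm α) (L : ℕ) (a : α) :
    x.shortPart L a ∉ (x.longPart L).support ↔ a ∉ (x.longPart L).support := by
  have h := x.disjoint_longPart_shortPart L
  have hc : x.longPart L (x.shortPart L a) = x.shortPart L (x.longPart L a) :=
    congrArg (fun σ : Perm α => σ a) h.commute.eq
  rw [notMem_support, notMem_support, hc, (x.shortPart L).injective.eq_iff]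

/-- The long-cycle part `y` of `x`, as an element of `Sym(Ω)`, where `Ω` is the support of `y`. -/
def longPartOnSupport (x : Perm α) (L : ℕ) : Perm {a // a ∈ (x.longPart L).support} :=
  (x.longPart L).subtypePerm fun _ => apply_mem_support

/-- The short-cycle part of `x`, as an element of the symmetric group on the complement of the
support of the long-cycle part of `x`. -/
def shortPartOnCompl (x : Perm α) (L : ℕ) : Perm {a // a ∉ (x.longPart L).support} :=
  (x.shortPart L).subtypePerm (x.shortPart_apply_notMem_support_longPart_iff L)

end Equiv.Perm

/-! For a `p`-element `x`, `⟨x⟩` is subnormal in `⟨x, g⟩` exactly when `g` normalizes some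
`p`-subgroup containing `x`. Hence the subnormalizer is generated by the normalizers of such
subgroups (`subnormalizer_eq_closure`), and in `Sym(n)` with `p = 2` everything reduces to orbits of
2-groups.

Suppose fewer than `2 ^ m` points lie in cycles shorter than `2 ^ m`, and let `Q` be a 2-group
containing `x`. A `Q`-orbit meeting a long cycle has size divisible by `2 ^ m`, and so has its set
of long points; its short points number a multiple of `2 ^ m` below `2 ^ m`, so there are none. The
long points are therefore those in `Q`-orbits of size at least `2 ^ m`, a set preserved by the
normalizer of `Q` (`two_pow_le_cycleLength_apply_iff`). This confines the subnormalizer to `Sym(Ω) ×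
Sym(Ωᶜ)`, and projecting `Q` to the factors gives the decomposition.

If no such gap exists, all transpositions are obtained by induction on the cycle length
(`swap_mem_subnormalizer_or_card_eq`). Cycles of equal length yield transpositions directly. A cycle
of length `2 ^ k` is joined to the shorter ones by exchanging it with a union of shorter cycles of
the same size. This can stall only when the number of points reached is a power of 2, which the
hypothesis on `n` rules out at the end. -/

/-! ### Subnormality and normalizers of `p`-subgroups. -/

section PSubgroups

variable {G : Type*} [Group G] {p : ℕ}

/-- Every group has a characteristic `p`-subgroup containing all normal `p`-subgroups. -/
theorem exists_characteristic_isPGroup_ge (p : ℕ) (G : Type*) [Group G] :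
    ∃ N : Subgroup G, N.Characteristic ∧ IsPGroup p N ∧
      ∀ M : Subgroup G, M.Normal → IsPGroup p M → M ≤ N := by
  refine ⟨sSup {M | M.Normal ∧ IsPGroup p M}, ?_,
    Sylow.sSup_of_normal _ (fun H hH => hH.2) (fun H hH => hH.1),
    fun M hM hp => le_sSup ⟨hM, hp⟩⟩
  rw [Subgroup.characteristic_iff_map_le]
  intro φ
  rw [Subgroup.map_le_iff_le_comap]
  refine sSup_le fun M hM => ?_
  rw [← Subgroup.map_le_iff_le_comap]
  exact le_sSup ⟨hM.1.map _ φ.surjective, hM.2.map _⟩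

/-- A normal `p`-subgroup of a subnormal subgroup lies in a normal `p`-subgroup. -/
theorem Subgroup.IsSubnormal.exists_normal_isPGroup_map_le {H : Subgroup G} (hH : H.IsSubnormal)
    (M : Subgroup H) (hM : M.Normal) (hp : IsPGroup p M) :
    ∃ N : Subgroup G, N.Normal ∧ IsPGroup p N ∧ M.map H.subtype ≤ N := by
  induction hH with
  | top =>
    exact ⟨M.map (Subgroup.subtype _), hM.map _ fun g => ⟨⟨g, trivial⟩, rfl⟩, hp.map _, le_rfl⟩
  | step H K hle _ hN ih =>
    -- Normality is not transitive, so the normal `p`-subgroup is first enlarged to a characteristic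
    -- one, which is normal in `K`.
    obtain ⟨C, hC, hCp, hCmax⟩ := exists_characteristic_isPGroup_ge p (H.subgroupOf K)
    let e : H.subgroupOf K ≃* H := Subgroup.subgroupOfEquivOfLe hle
    have h1 : M.map e.symm.toMonoidHom ≤ C :=
      hCmax _ (hM.map _ e.symm.surjective) (hp.map _)
    obtain ⟨N, hNn, hNp, hNle⟩ :=
      ih (C.map (H.subgroupOf K).subtype) inferInstance (hCp.map _)
    refine ⟨N, hNn, hNp, ?_⟩
    rintro _ ⟨y, hy, rfl⟩
    refine hNle ⟨(e.symm y : K), ⟨e.symm y, h1 ⟨y, hy, rfl⟩, rfl⟩, ?_⟩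
    exact congrArg Subtype.val (e.apply_symm_apply y)

/-- A proper subgroup is strictly smaller than its normalizer, so in a finite group iterated
normalizers reach the whole group. -/
theorem Subgroup.isSubnormal_of_normalizerCondition [Finite G] (h : NormalizerCondition G)
    (H : Subgroup G) : H.IsSubnormal := by
  induction H using WellFoundedGT.induction with
  | ind H ih =>
    rcases eq_or_ne H ⊤ with rfl | hne
    · exact .top
    · exact .step H _ Subgroup.le_normalizer (ih _ (h H hne.lt_top))
        Subgroup.normal_in_normalizer

theorem Subgroup.IsSubnormal.of_le_isPGroup [Finite G] [Fact p.Prime] {H N : Subgroup G}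
    (hN : N.Normal) (hp : IsPGroup p N) (h : H ≤ N) : H.IsSubnormal := by
  have : Group.IsNilpotent N := hp.isNilpotent
  exact .trans h (isSubnormal_of_normalizerCondition Group.normalizerCondition_of_isNilpotent _)
    hN.isSubnormal

/-- For a `p`-element `x`, the subgroup `⟨x⟩` is subnormal in `⟨x, g⟩` if and only if `g`
normalizes a `p`-subgroup containing `x`. -/
theorem isSubnormal_zpowers_iff_exists_isPGroup [Finite G] [Fact p.Prime] {x : G}
    (hx : IsPGroup p (Subgroup.zpowers x)) (g : G) :
    ((Subgroup.zpowers x).subgroupOf (Subgroup.closure {x, g})).IsSubnormal ↔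
      ∃ Q : Subgroup G, IsPGroup p Q ∧ x ∈ Q ∧ g ∈ Subgroup.normalizer (Q : Set G) := by
  have hxH : x ∈ Subgroup.closure {x, g} := Subgroup.subset_closure (by simp)
  have hgH : g ∈ Subgroup.closure {x, g} := Subgroup.subset_closure (by simp)
  constructor
  · intro h
    obtain ⟨N, hN, hNp, hle⟩ := h.exists_normal_isPGroup_map_le (p := p) ⊤ inferInstance
      (IsPGroup.to_subgroup (hx.comap_of_injective _ (Subgroup.subtype_injective _)) ⊤)
    refine ⟨N.map (Subgroup.subtype _), hNp.map _, ?_, ?_⟩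
    · exact ⟨⟨x, hxH⟩, hle ⟨⟨⟨x, hxH⟩, Subgroup.mem_zpowers x⟩, trivial, rfl⟩, rfl⟩
    · refine Subgroup.le_normalizer_map _ ⟨⟨g, hgH⟩, ?_, rfl⟩
      rw [Subgroup.normalizer_eq_top]
      trivial
  · rintro ⟨Q, hQ, hxQ, hgQ⟩
    have hle : Subgroup.closure {x, g} ≤ Subgroup.normalizer (Q : Set G) := by
      rw [Subgroup.closure_le]
      rintro _ (rfl | rfl)
      · exact Subgroup.le_normalizer hxQ
      · exact hgQ
    refine .of_le_isPGroup (p := p) (N := Q.subgroupOf _)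
      (Subgroup.normal_subgroupOf_of_le_normalizer hle)
      (hQ.comap_of_injective _ (Subgroup.subtype_injective _)) ?_
    exact Subgroup.comap_mono (by simpa using hxQ)

theorem isPGroup_zpowers_of_orderOf_eq {x : G} {a : ℕ} (h : orderOf x = p ^ a) :
    IsPGroup p (Subgroup.zpowers x) :=
  .of_card (n := a) (by rw [Nat.card_zpowers, h])

theorem subnormalizer_eq_closure [Finite G] [Fact p.Prime] {x : G}
    (hx : IsPGroup p (Subgroup.zpowers x)) :
    subnormalizer x = Subgroup.closure {g | ∃ Q : Subgroup G, IsPGroup p Q ∧ x ∈ Q ∧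
      g ∈ Subgroup.normalizer (Q : Set G)} := by
  unfold subnormalizer
  simp only [isSubnormal_zpowers_iff_exists_isPGroup hx]

/-- The source of explicit elements below: it suffices to place them in a common `p`-subgroup with
`x`. -/
theorem IsPGroup.le_subnormalizer [Finite G] [Fact p.Prime] {x : G} {Q : Subgroup G}
    (hQ : IsPGroup p Q) (hx : x ∈ Q) : Q ≤ subnormalizer x := by
  rw [subnormalizer_eq_closure (hQ.to_le (by simpa using hx))]
  exact fun g hg => Subgroup.subset_closure ⟨Q, hQ, hx, Subgroup.le_normalizer hg⟩

theorem IsPGroup.subgroup_prod {G' : Type*} [Group G'] {H : Subgroup G} {K : Subgroup G'}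
    (hH : IsPGroup p H) (hK : IsPGroup p K) : IsPGroup p (H.prod K) := by
  rintro ⟨⟨h, k⟩, hh, hk⟩
  obtain ⟨i, hi⟩ := hH ⟨h, hh⟩
  obtain ⟨j, hj⟩ := hK ⟨k, hk⟩
  refine ⟨i + j, ?_⟩
  simp only [Subtype.ext_iff, Subgroup.coe_pow, Subgroup.coe_one] at hi hj
  ext
  · simp [pow_add, pow_mul, hi]
  · simp [pow_add, mul_comm (p ^ i), pow_mul, hj]

end PSubgroups

/-! ### Subnormalizers in direct products. -/

section Products

variable {G G₁ G₂ : Type*} [Group G] [Group G₁] [Group G₂] [Finite G] [Finite G₁] [Finite G₂]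
  {p : ℕ} [Fact p.Prime]

/-- Generators are lifted one coordinate at a time, pairing their `p`-subgroup with the cyclic group
of the other component. -/
theorem map_prod_subnormalizer_le (φ : G₁ × G₂ →* G) {y : G₁} {z : G₂}
    (hy : IsPGroup p (Subgroup.zpowers y)) (hz : IsPGroup p (Subgroup.zpowers z)) :
    ((subnormalizer y).prod (subnormalizer z)).map φ ≤ subnormalizer (φ (y, z)) := by
  have key : ∀ (Q₁ : Subgroup G₁) (Q₂ : Subgroup G₂) (g : G₁ × G₂), IsPGroup p Q₁ →
      IsPGroup p Q₂ → y ∈ Q₁ → z ∈ Q₂ → g.1 ∈ Subgroup.normalizer (Q₁ : Set G₁) →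
      g.2 ∈ Subgroup.normalizer (Q₂ : Set G₂) → φ g ∈ subnormalizer (φ (y, z)) := by
    intro Q₁ Q₂ g h₁ h₂ hy hz hg₁ hg₂
    have hQ : IsPGroup p ((Q₁.prod Q₂).map φ) := (h₁.subgroup_prod h₂).map φ
    have hxQ : φ (y, z) ∈ (Q₁.prod Q₂).map φ := ⟨(y, z), ⟨hy, hz⟩, rfl⟩
    rw [subnormalizer_eq_closure (hQ.to_le (by simpa using hxQ))]
    refine Subgroup.subset_closure
      ⟨_, hQ, hxQ, Subgroup.le_normalizer_map _ ⟨g, ?_, rfl⟩⟩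
    rw [SetLike.mem_coe, Subgroup.mem_normalizer_iff] at *
    intro h
    simp only [Subgroup.mem_prod] at *
    exact and_congr (hg₁ h.1) (hg₂ h.2)
  have h₁ : subnormalizer y ≤ (subnormalizer (φ (y, z))).comap (φ.comp (.inl G₁ G₂)) := by
    conv_lhs => rw [subnormalizer_eq_closure hy]
    rw [Subgroup.closure_le]
    rintro g ⟨Q, hQ, hyQ, hgQ⟩
    exact key Q _ (g, 1) hQ hz hyQ (Subgroup.mem_zpowers z) hgQ (one_mem _)
  have h₂ : subnormalizer z ≤ (subnormalizer (φ (y, z))).comap (φ.comp (.inr G₁ G₂)) := by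
    conv_lhs => rw [subnormalizer_eq_closure hz]
    rw [Subgroup.closure_le]
    rintro g ⟨Q, hQ, hzQ, hgQ⟩
    exact key _ Q (1, g) hy hQ (Subgroup.mem_zpowers y) hzQ (one_mem _) hgQ
  rintro _ ⟨⟨g, h⟩, ⟨hg, hh⟩, rfl⟩
  have hg' : φ (g, 1) ∈ subnormalizer (φ (y, z)) := h₁ hg
  have hh' : φ (1, h) ∈ subnormalizer (φ (y, z)) := h₂ hh
  simpa [← map_mul] using mul_mem hg' hh'

/-- By `hrange` each generator pulls back along `φ`; its components normalize the projections of the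
pulled-back `p`-subgroup. -/
theorem subnormalizer_le_map_prod {φ : G₁ × G₂ →* G} (hφ : Function.Injective φ) {y : G₁} {z : G₂}
    (hx : IsPGroup p (Subgroup.zpowers (φ (y, z))))
    (hrange : ∀ Q : Subgroup G, IsPGroup p Q → φ (y, z) ∈ Q →
      Subgroup.normalizer (Q : Set G) ≤ φ.range) :
    subnormalizer (φ (y, z)) ≤ ((subnormalizer y).prod (subnormalizer z)).map φ := by
  conv_lhs => rw [subnormalizer_eq_closure hx]
  rw [Subgroup.closure_le]
  rintro g ⟨Q, hQ, hxQ, hgQ⟩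
  obtain ⟨g, rfl⟩ := hrange Q hQ hxQ hgQ
  have hQ' : IsPGroup p (Q.comap φ) := hQ.comap_of_injective φ hφ
  have hg' : g ∈ Subgroup.normalizer (Q.comap φ : Set (G₁ × G₂)) := by
    rw [Subgroup.mem_normalizer_iff] at hgQ ⊢
    intro h
    simpa using hgQ (φ h)
  have hfst : IsPGroup p ((Q.comap φ).map (.fst G₁ G₂)) := hQ'.map _
  have hsnd : IsPGroup p ((Q.comap φ).map (.snd G₁ G₂)) := hQ'.map _
  have hy : y ∈ (Q.comap φ).map (.fst G₁ G₂) := ⟨(y, z), hxQ, rfl⟩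
  have hz : z ∈ (Q.comap φ).map (.snd G₁ G₂) := ⟨(y, z), hxQ, rfl⟩
  refine ⟨g, ⟨?_, ?_⟩, rfl⟩
  · rw [subnormalizer_eq_closure (hfst.to_le (by simpa using hy))]
    exact Subgroup.subset_closure
      ⟨_, hfst, hy, Subgroup.le_normalizer_map _ ⟨g, hg', rfl⟩⟩
  · rw [subnormalizer_eq_closure (hsnd.to_le (by simpa using hz))]
    exact Subgroup.subset_closure
      ⟨_, hsnd, hz, Subgroup.le_normalizer_map _ ⟨g, hg', rfl⟩⟩

end Products

/-! ### Unions of cycles and cycle lengths. -/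

namespace Equiv.Perm

variable {α : Type*} {x : Perm α}

/-- A set of points is cycle-closed if it is a union of cycles. -/
def IsCycleClosed (x : Perm α) (A : Finset α) : Prop :=
  ∀ a ∈ A, ∀ b, x.SameCycle a b → b ∈ A

namespace IsCycleClosed

variable {A B : Finset α}

theorem mem_iff (hA : x.IsCycleClosed A) {a b : α} (h : x.SameCycle a b) : a ∈ A ↔ b ∈ A :=
  ⟨fun ha => hA a ha b h, fun hb => hA b hb a h.symm⟩

variable [DecidableEq α]

theorem union (hA : x.IsCycleClosed A) (hB : x.IsCycleClosed B) : x.IsCycleClosed (A ∪ B) := by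
  intro a ha b hb
  rw [Finset.mem_union] at *
  exact ha.imp (hA a · b hb) (hB a · b hb)

theorem sdiff (hA : x.IsCycleClosed A) (hB : x.IsCycleClosed B) : x.IsCycleClosed (A \ B) := by
  intro a ha b hb
  rw [Finset.mem_sdiff] at *
  exact ⟨hA a ha.1 b hb, fun h => ha.2 (hB b h a hb.symm)⟩

theorem inter (hA : x.IsCycleClosed A) (hB : x.IsCycleClosed B) : x.IsCycleClosed (A ∩ B) := by
  intro a ha b hb
  rw [Finset.mem_inter] at *
  exact ⟨hA a ha.1 b hb, hB a ha.2 b hb⟩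

end IsCycleClosed

variable [DecidableEq α] [Fintype α]

/-- The set of points of the cycle of `x` through `a`. -/
def cycleFinset (x : Perm α) (a : α) : Finset α := {b | x.SameCycle a b}

@[simp]
theorem mem_cycleFinset {a b : α} : b ∈ x.cycleFinset a ↔ x.SameCycle a b := by
  simp [cycleFinset]

theorem self_mem_cycleFinset (a : α) : a ∈ x.cycleFinset a :=
  mem_cycleFinset.mpr (.refl x a)

theorem SameCycle.cycleFinset_eq {a b : α} (h : x.SameCycle a b) :
    x.cycleFinset a = x.cycleFinset b := by
  ext c
  simp only [mem_cycleFinset]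
  exact ⟨h.symm.trans, h.trans⟩

/-- The length of the cycle of `x` through `a`. -/
def cycleLength (x : Perm α) (a : α) : ℕ := (x.cycleFinset a).card

theorem SameCycle.cycleLength_eq {a b : α} (h : x.SameCycle a b) :
    x.cycleLength a = x.cycleLength b := by
  rw [cycleLength, cycleLength, h.cycleFinset_eq]

theorem cycleLength_pos (a : α) : 0 < x.cycleLength a :=
  Finset.card_pos.mpr ⟨a, self_mem_cycleFinset a⟩

theorem coe_cycleFinset (a : α) :
    (x.cycleFinset a : Set α) = MulAction.orbit (Subgroup.zpowers x) a := by
  ext b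
  simp only [Finset.mem_coe, mem_cycleFinset, SameCycle, MulAction.mem_orbit_iff,
    Subtype.exists, Subgroup.mem_zpowers_iff]
  constructor
  · rintro ⟨i, hi⟩
    exact ⟨_, ⟨i, rfl⟩, hi⟩
  · rintro ⟨_, ⟨i, rfl⟩, hi⟩
    exact ⟨i, hi⟩

theorem cycleLength_eq_card_orbit (a : α) :
    x.cycleLength a = Nat.card (MulAction.orbit (Subgroup.zpowers x) a) := by
  rw [cycleLength, ← coe_cycleFinset, Nat.card_coe_set_eq, Set.ncard_coe_finset]

theorem exists_cycleLength_eq_two_pow (hx : IsPGroup 2 (Subgroup.zpowers x)) (a : α) :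
    ∃ k, x.cycleLength a = 2 ^ k := by
  rw [cycleLength_eq_card_orbit]
  exact hx.card_orbit a

theorem zpow_apply_eq_self_iff (a : α) (i : ℤ) :
    (x ^ i) a = a ↔ (x.cycleLength a : ℤ) ∣ i := by
  classical
  rw [cycleLength_eq_card_orbit, Nat.card_eq_fintype_card, ← MulAction.minimalPeriod_eq_card x a]
  exact MulAction.zpow_smul_eq_iff_minimalPeriod_dvd (a := x) (b := a)

theorem isCycleClosed_cycleFinset (a : α) : x.IsCycleClosed (x.cycleFinset a) := by
  intro b hb c hc
  rw [mem_cycleFinset] at *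
  exact hb.trans hc

theorem isCycleClosed_filter (p : ℕ → Prop) [DecidablePred p] :
    x.IsCycleClosed {a | p (x.cycleLength a)} := by
  intro a ha b hb
  rw [Finset.mem_filter] at *
  exact ⟨Finset.mem_univ _, hb.cycleLength_eq ▸ ha.2⟩

namespace IsCycleClosed

variable {A B : Finset α}

theorem cycleFinset_subset (hA : x.IsCycleClosed A) {a : α} (ha : a ∈ A) :
    x.cycleFinset a ⊆ A := fun b hb => hA a ha b (mem_cycleFinset.mp hb)

theorem dvd_card {L : ℕ} (hA : x.IsCycleClosed A) (h : ∀ a ∈ A, L ∣ x.cycleLength a) :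
    L ∣ A.card := by
  induction A using Finset.strongInduction with
  | H A ih =>
    rcases A.eq_empty_or_nonempty with rfl | ⟨a, ha⟩
    · simp
    · have hs := hA.cycleFinset_subset ha
      rw [← Finset.card_sdiff_add_card_eq_card hs]
      refine dvd_add (ih _ (Finset.sdiff_ssubset hs ⟨a, self_mem_cycleFinset a⟩)
        (hA.sdiff (isCycleClosed_cycleFinset a)) fun b hb => h b (Finset.mem_sdiff.mp hb).1) ?_
      exact h a ha

/-- A union of cycles whose lengths are powers of `2` not exceeding `2 ^ k`, with at least `2 ^ k`
points, contains a union of cycles with exactly `2 ^ k` points. -/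
theorem exists_subset_card_eq_two_pow (hx : IsPGroup 2 (Subgroup.zpowers x)) {k : ℕ}
    (hA : x.IsCycleClosed A) (hle : ∀ a ∈ A, x.cycleLength a ≤ 2 ^ k) (hcard : 2 ^ k ≤ A.card) :
    ∃ B ⊆ A, x.IsCycleClosed B ∧ B.card = 2 ^ k := by
  induction k generalizing A with
  | zero =>
    obtain ⟨a, ha⟩ : A.Nonempty := Finset.card_pos.mp (by simpa using hcard)
    exact ⟨x.cycleFinset a, hA.cycleFinset_subset ha, isCycleClosed_cycleFinset a,
      le_antisymm (hle a ha) (cycleLength_pos a)⟩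
  | succ k ih =>
    -- Either one cycle already has the right size, or all lengths are at most `2 ^ k` and two
    -- disjoint unions of size `2 ^ k` can be chosen in succession.
    by_cases hex : ∃ a ∈ A, x.cycleLength a = 2 ^ (k + 1)
    · obtain ⟨a, ha, hl⟩ := hex
      exact ⟨x.cycleFinset a, hA.cycleFinset_subset ha, isCycleClosed_cycleFinset a, hl⟩
    · have hle' : ∀ a ∈ A, x.cycleLength a ≤ 2 ^ k := by
        intro a ha
        obtain ⟨j, hj⟩ := exists_cycleLength_eq_two_pow hx a
        have h₁ := hle a ha
        have h₂ : x.cycleLength a ≠ 2 ^ (k + 1) := fun h => hex ⟨a, ha, h⟩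
        rw [hj] at h₁ h₂ ⊢
        have h₃ := (Nat.pow_le_pow_iff_right (by norm_num : 1 < 2)).mp h₁
        have h₄ : j ≠ k + 1 := fun h => h₂ (by rw [h])
        exact Nat.pow_le_pow_right (by norm_num) (by omega)
      rw [pow_succ] at hcard
      obtain ⟨B, hBA, hB, hBc⟩ := ih hA hle' (by omega)
      have hdiff := Finset.card_sdiff_add_card_eq_card hBA
      obtain ⟨B', hBA', hB', hBc'⟩ := ih (hA.sdiff hB)
        (fun a ha => hle' a (Finset.mem_sdiff.mp ha).1) (by omega)
      refine ⟨B ∪ B', Finset.union_subset hBA (hBA'.trans Finset.sdiff_subset), hB.union hB', ?_⟩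
      rw [Finset.card_union_of_disjoint, hBc, hBc', pow_succ, mul_two]
      exact (Finset.sdiff_disjoint.mono_left hBA').symm

end IsCycleClosed

/-! ### Permutations in the subnormalizer of a 2-element. -/

/-- Points of distinct cycles of the same length are exchanged by a transposition in the
subnormalizer. -/
theorem swap_mem_subnormalizer (hx : IsPGroup 2 (Subgroup.zpowers x)) {a b : α}
    (hlen : x.cycleLength a = x.cycleLength b) (hab : ¬ x.SameCycle a b) :
    swap a b ∈ subnormalizer x := by
  -- Equal cycle lengths make `(x ^ i) a ↔ (x ^ i) b` a well-defined matching. Permutations that fix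
  -- each point or send it to its partner form a group `E` of exponent dividing 2, normalized by
  -- `x`, so `⟨x⟩E` is a 2-group.
  let R : α → α → Prop := fun c d =>
    ∃ i : ℤ, (c = (x ^ i) a ∧ d = (x ^ i) b) ∨ (c = (x ^ i) b ∧ d = (x ^ i) a)
  have hper : ∀ i j : ℤ, (x ^ i) a = (x ^ j) a ↔ (x ^ i) b = (x ^ j) b := by
    have aux : ∀ (i j : ℤ) (c : α), (x ^ i) c = (x ^ j) c ↔ (x.cycleLength c : ℤ) ∣ -j + i := by
      intro i j c
      rw [← zpow_apply_eq_self_iff, zpow_add, mul_apply, zpow_neg, inv_eq_iff_eq]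
    intro i j
    rw [aux, aux, hlen]
  have hne : ∀ i j : ℤ, (x ^ i) a ≠ (x ^ j) b := by
    intro i j h
    apply hab
    have h' : x.SameCycle a ((x ^ j) b) := ⟨i, h⟩
    simpa using h'
  have hsymm : ∀ c d, R c d → R d c := by
    rintro c d ⟨i, h | h⟩
    · exact ⟨i, .inr h.symm⟩
    · exact ⟨i, .inl h.symm⟩
  have huniq : ∀ c d d', R c d → R c d' → d = d' := by
    rintro c d d' ⟨i, ⟨rfl, rfl⟩ | ⟨rfl, rfl⟩⟩ ⟨j, ⟨h, rfl⟩ | ⟨h, rfl⟩⟩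
    · exact (hper i j).mp h
    · exact absurd h (hne i j)
    · exact absurd h.symm (hne j i)
    · exact (hper i j).mpr h
  have hsq : ∀ g : Perm α, (∀ c, g c = c ∨ R c (g c)) → ∀ c, g (g c) = c := by
    intro g hg c
    rcases hg c with h | h
    · rw [h, h]
    · rcases hg (g c) with h' | h'
      · rw [h', g.injective h']
      · exact huniq _ _ _ h' (hsymm _ _ h)
  let E : Subgroup (Perm α) :=
    { carrier := {g | ∀ c, g c = c ∨ R c (g c)}
      one_mem' := fun c => .inl rfl
      mul_mem' := by
        intro g h hg hh c
        rw [mul_apply]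
        rcases hh c with h₁ | h₁
        · rw [h₁]
          exact hg c
        · rcases hg (h c) with h₂ | h₂
          · rw [h₂]
            exact .inr h₁
          · exact .inl (huniq _ _ _ h₂ (hsymm _ _ h₁))
      inv_mem' := by
        intro g hg c
        have : g⁻¹ c = g c := by rw [inv_eq_iff_eq, hsq g hg]
        rw [this]
        exact hg c }
  have hE : IsPGroup 2 E := by
    rintro ⟨g, hg⟩
    refine ⟨1, Subtype.ext (Equiv.ext fun c => ?_)⟩
    simpa [pow_two] using hsq g hg c
  have hR : ∀ (k : ℤ) c d, R c d → R ((x ^ k) c) ((x ^ k) d) := by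
    rintro k c d ⟨i, ⟨rfl, rfl⟩ | ⟨rfl, rfl⟩⟩
    · exact ⟨k + i, .inl (by simp [zpow_add])⟩
    · exact ⟨k + i, .inr (by simp [zpow_add])⟩
  have hconj : ∀ (k : ℤ) (g : Perm α), g ∈ E → x ^ k * g * (x ^ k)⁻¹ ∈ E := by
    intro k g hg c
    simp only [mul_apply]
    rcases hg ((x ^ k)⁻¹ c) with h | h
    · left
      rw [h, ← mul_apply, mul_inv_cancel, one_apply]
    · right
      simpa using hR k _ _ h
  have hnorm : Subgroup.zpowers x ≤ Subgroup.normalizer (E : Set (Perm α)) := by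
    rintro _ ⟨k, rfl⟩
    rw [Subgroup.mem_normalizer_iff]
    refine fun g => ⟨hconj k g, fun h => ?_⟩
    have := hconj (-k) _ h
    simpa [mul_assoc] using this
  have hmem : swap a b ∈ E := by
    intro c
    rcases eq_or_ne c a with rfl | hca
    · right
      exact ⟨0, .inl (by simp)⟩
    rcases eq_or_ne c b with rfl | hcb
    · right
      exact ⟨0, .inr (by simp)⟩
    · exact .inl (swap_apply_of_ne_of_ne hca hcb)
  exact (hx.to_sup_of_normal_right' hE hnorm).le_subnormalizer
    (Subgroup.mem_sup_left (Subgroup.mem_zpowers x)) (Subgroup.mem_sup_right hmem)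

end Equiv.Perm

namespace Equiv.Perm

variable {α : Type*} [DecidableEq α]

/-- This exchange need not respect any cycles; it only feeds the Sylow argument that follows. -/
theorem exists_involution_exchanging {C D : Finset α} (hdisj : _root_.Disjoint C D)
    (hcard : C.card = D.card) :
    ∃ τ : Perm α, τ * τ = 1 ∧ (∀ a, τ a ∈ C ↔ a ∈ D) ∧ (∀ a, τ a ∈ D ↔ a ∈ C) ∧
      ∀ a, a ∉ C → a ∉ D → τ a = a := by
  let f : C ≃ D := Finset.equivOfCardEq hcard
  let F : α → α := fun a =>
    if h : a ∈ C then f ⟨a, h⟩ else if h : a ∈ D then f.symm ⟨a, h⟩ else a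
  have hCD : ∀ a ∈ D, a ∉ C := fun a ha h => Finset.disjoint_left.mp hdisj h ha
  have hFC : ∀ a (h : a ∈ C), F a = f ⟨a, h⟩ := fun a h => dif_pos h
  have hFD : ∀ a (h : a ∈ D), F a = f.symm ⟨a, h⟩ := fun a h => by
    simp only [F, dif_neg (hCD a h), dif_pos h]
  have hF : ∀ a, a ∉ C → a ∉ D → F a = a := fun a h h' => by
    simp only [F, dif_neg h, dif_neg h']
  have hinv : Function.Involutive F := by
    intro a
    by_cases hC : a ∈ C
    · rw [hFC a hC, hFD _ (f ⟨a, hC⟩).2]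
      simp
    · by_cases hD : a ∈ D
      · rw [hFD a hD, hFC _ (f.symm ⟨a, hD⟩).2]
        simp
      · rw [hF a hC hD, hF a hC hD]
  have hDC : ∀ a ∈ C, F a ∈ D := fun a h => by
    rw [hFC a h]
    exact (f ⟨a, h⟩).2
  have hCD' : ∀ a ∈ D, F a ∈ C := fun a h => by
    rw [hFD a h]
    exact (f.symm ⟨a, h⟩).2
  refine ⟨hinv.toPerm F, Equiv.ext hinv, fun a => ⟨fun h => ?_, hCD' a⟩,
    fun a => ⟨fun h => ?_, hDC a⟩, hF⟩
  · exact hinv a ▸ hDC _ h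
  · exact hinv a ▸ hCD' _ h

/-- Membership in `U` of transpositions is preserved when `U` moves the transposed points. -/
theorem swap_apply_mem {U : Subgroup (Perm α)} {g : Perm α} (hg : g ∈ U) {a b : α}
    (h : swap a b ∈ U) : swap (g a) (g b) ∈ U := by
  rw [swap_apply_apply]
  exact mul_mem (mul_mem hg h) (inv_mem hg)

variable [Fintype α] {x : Perm α}

/-- Two disjoint unions of cycles of a `2`-element `x` with the same number of points are exchanged
by an element of the subnormalizer of `x` that fixes all other points. -/
theorem exists_mem_subnormalizer_exchanging (hx : IsPGroup 2 (Subgroup.zpowers x))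
    {C D : Finset α} (hC : x.IsCycleClosed C) (hD : x.IsCycleClosed D) (hdisj : _root_.Disjoint C D)
    (hcard : C.card = D.card) :
    ∃ τ ∈ subnormalizer x, (∀ a ∈ C, τ a ∈ D) ∧ (∀ a ∈ D, τ a ∈ C) ∧
      ∀ a, a ∉ C → a ∉ D → τ a = a := by
  rcases C.eq_empty_or_nonempty with rfl | ⟨c₀, hc₀⟩
  · have : D = ∅ := Finset.card_eq_zero.mp (by simpa using hcard.symm)
    subst this
    exact ⟨1, one_mem _, by simp, by simp, by simp⟩
  have hCD : ∀ a ∈ C, a ∉ D := fun a h h' => Finset.disjoint_left.mp hdisj h h'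
  have hxC : ∀ (i : ℤ) a, (x ^ i) a ∈ C ↔ a ∈ C := fun i a =>
    (hC.mem_iff ⟨i, rfl⟩).symm
  have hxD : ∀ (i : ℤ) a, (x ^ i) a ∈ D ↔ a ∈ D := fun i a =>
    (hD.mem_iff ⟨i, rfl⟩).symm
  let Stab : Perm α → Prop := fun g => (∀ a, g a ∈ C ↔ a ∈ C) ∧ ∀ a, g a ∈ D ↔ a ∈ D
  let Exch : Perm α → Prop := fun g => (∀ a, g a ∈ C ↔ a ∈ D) ∧ ∀ a, g a ∈ D ↔ a ∈ C
  -- Elements of `W` preserve or exchange `C` and `D`, and agree with a power of `x` elsewhere, so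
  -- that their action outside can later be undone.
  let W : Subgroup (Perm α) :=
    { carrier := {g | (Stab g ∨ Exch g) ∧ ∃ i : ℤ, ∀ a, a ∉ C → a ∉ D → g a = (x ^ i) a}
      one_mem' := ⟨.inl ⟨fun _ => Iff.rfl, fun _ => Iff.rfl⟩, 0, fun _ _ _ => by simp⟩
      mul_mem' := by
        rintro g h ⟨hg, i, hi⟩ ⟨hh, j, hj⟩
        refine ⟨?_, i + j, fun a haC haD => ?_⟩
        · rcases hg with ⟨hg, hg'⟩ | ⟨hg, hg'⟩ <;> rcases hh with ⟨hh, hh'⟩ | ⟨hh, hh'⟩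
          · exact .inl ⟨by simp [hg, hh], by simp [hg', hh']⟩
          · exact .inr ⟨by simp [hg, hh], by simp [hg', hh']⟩
          · exact .inr ⟨by simp [hg, hh'], by simp [hg', hh]⟩
          · exact .inl ⟨by simp [hg, hh'], by simp [hg', hh]⟩
        · rw [mul_apply, hj a haC haD, hi _ (by rwa [hxC]) (by rwa [hxD]), zpow_add, mul_apply]
      inv_mem' := by
        rintro g ⟨hg, i, hi⟩
        refine ⟨?_, -i, fun a haC haD => ?_⟩
        · rcases hg with ⟨hg, hg'⟩ | ⟨hg, hg'⟩
          · exact .inl ⟨fun a => by simpa using (hg (g⁻¹ a)).symm, fun a => by simpa using (hg' (g⁻¹ a)).symm⟩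
          · exact .inr ⟨fun a => by simpa using (hg' (g⁻¹ a)).symm, fun a => by simpa using (hg (g⁻¹ a)).symm⟩
        · rw [inv_eq_iff_eq, hi _ (by rwa [hxC]) (by rwa [hxD]), ← mul_apply, ← zpow_add]
          simp }
  have hxW : x ∈ W := ⟨.inl ⟨by simpa using hxC 1, by simpa using hxD 1⟩, 1, by simp⟩
  obtain ⟨τ, hτ, hτC, hτD, hτR⟩ := exists_involution_exchanging hdisj hcard
  have hτW : τ ∈ W := ⟨.inr ⟨hτC, hτD⟩, 0, by simpa using hτR⟩
  obtain ⟨P, hP⟩ := (show IsPGroup 2 ((Subgroup.zpowers x).subgroupOf W) from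
    hx.comap_of_injective _ (Subgroup.subtype_injective _)).exists_le_sylow
  obtain ⟨P', hP'⟩ := (isPGroup_zpowers_of_orderOf_eq (p := 2) (a := 1)
    (x := (⟨τ, hτW⟩ : W)) (by
      rw [pow_one, orderOf_eq_prime_iff, pow_two]
      refine ⟨Subtype.ext hτ, fun h => ?_⟩
      have h' : τ c₀ = c₀ := congrArg (fun g : W => g.1 c₀) h
      exact hCD _ hc₀ (h' ▸ (hτD c₀).mpr hc₀))).exists_le_sylow
  -- If a Sylow subgroup containing `x` had no exchanging element, neither would its conjugates in
  -- `W`; but one of them contains the involution `τ`.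
  have hex : ∃ g ∈ P, Exch (g : Perm α) := by
    by_contra hno
    have hstab : ∀ g ∈ P, Stab (g : Perm α) := fun g hg =>
      g.2.1.resolve_right fun h => hno ⟨g, hg, h⟩
    obtain ⟨w, hw⟩ := MulAction.exists_smul_eq W P P'
    have hmem : (⟨τ, hτW⟩ : W) ∈ P' := hP' (Subgroup.mem_zpowers _)
    rw [← hw] at hmem
    obtain ⟨g, hg, hgτ⟩ := hmem
    have hgτ' : (w : Perm α) * g * (w : Perm α)⁻¹ = τ := congrArg Subtype.val hgτ
    have hcomm : ∀ a, τ ((w : Perm α) a) = (w : Perm α) ((g : Perm α) a) := by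
      intro a
      simp [← hgτ']
    obtain ⟨hs, hs'⟩ := hstab g hg
    have hc : τ c₀ ∈ D := (hτD c₀).mpr hc₀
    obtain ⟨b, hb⟩ := (w : Perm α).surjective c₀
    rw [← hb, hcomm] at hc
    rw [← hb] at hc₀
    rcases w.2.1 with ⟨h, h'⟩ | ⟨h, h'⟩
    · rw [h', hs'] at hc
      rw [h] at hc₀
      exact hCD _ hc₀ hc
    · rw [h', hs] at hc
      rw [h] at hc₀
      exact hCD _ hc hc₀
  obtain ⟨g, hgP, hgC, hgD⟩ := hex
  obtain ⟨i, hi⟩ := g.2.2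
  have hQ : IsPGroup 2 ((P : Subgroup W).map W.subtype) := P.isPGroup'.map _
  have hxQ : x ∈ (P : Subgroup W).map W.subtype :=
    ⟨⟨x, hxW⟩, hP (Subgroup.mem_zpowers x), rfl⟩
  have hle := hQ.le_subnormalizer hxQ
  refine ⟨g * x ^ (-i), mul_mem (hle ⟨g, hgP, rfl⟩) (zpow_mem (hle hxQ) _), ?_, ?_, ?_⟩
  · intro a ha
    rwa [mul_apply, hgD, hxC]
  · intro a ha
    rwa [mul_apply, hgC, hxD]
  · intro a haC haD
    rw [mul_apply, hi _ (by rwa [hxC]) (by rwa [hxD]), ← mul_apply, ← zpow_add]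
    simp

/-- The points in cycles of length less than `2 ^ k` of a `2`-element are permuted arbitrarily by
the subnormalizer, unless their number is a power of `2` not exceeding `2 ^ k`. -/
theorem swap_mem_subnormalizer_or_card_eq (hx : IsPGroup 2 (Subgroup.zpowers x))
    (H : ∀ a b, x.cycleLength b < x.cycleLength a →
      x.cycleLength a ≤ (Finset.univ.filter fun c => x.cycleLength c < x.cycleLength a).card)
    (k : ℕ) :
    (∀ a b, x.cycleLength a < 2 ^ k → x.cycleLength b < 2 ^ k → swap a b ∈ subnormalizer x) ∨
      ∃ j ≤ k, (Finset.univ.filter fun c => x.cycleLength c < 2 ^ k).card = 2 ^ j := by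
  induction k with
  | zero =>
    left
    intro a b ha
    have := cycleLength_pos (x := x) a
    simp at ha
    omega
  | succ k ih =>
    set U := subnormalizer x with hU
    set S : Finset α := Finset.univ.filter fun c => x.cycleLength c < 2 ^ k with hS
    have hSc : x.IsCycleClosed S := isCycleClosed_filter (x := x) (· < 2 ^ k)
    have hmemS : ∀ {a}, a ∈ S ↔ x.cycleLength a < 2 ^ k := by simp [hS]
    have hsplit : ∀ a, x.cycleLength a < 2 ^ (k + 1) → a ∈ S ∨ x.cycleLength a = 2 ^ k := by
      intro a ha
      rw [hmemS]
      obtain ⟨j, hj⟩ := exists_cycleLength_eq_two_pow hx a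
      rw [hj] at ha ⊢
      have h₁ := (Nat.pow_lt_pow_iff_right (by norm_num : 1 < 2)).mp ha
      rcases Nat.lt_succ_iff_lt_or_eq.mp h₁ with h | rfl
      · exact .inl (Nat.pow_lt_pow_right (by norm_num) h)
      · exact .inr rfl
    have htrans : ∀ {a b c}, swap a b ∈ U → swap b c ∈ U → swap a c ∈ U :=
      fun h h' => SubmonoidClass.swap_mem_trans U h h'
    have hcomm : ∀ {a b}, swap a b ∈ U → swap b a ∈ U := fun h => by rwa [swap_comm]
    -- If every relevant point is linked to a fixed one, then all of them are linked.
    have hstar : ∀ c, (∀ a, x.cycleLength a < 2 ^ (k + 1) → swap a c ∈ U) →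
        ∀ a b, x.cycleLength a < 2 ^ (k + 1) → x.cycleLength b < 2 ^ (k + 1) → swap a b ∈ U :=
      fun c h a b ha hb => htrans (h a ha) (hcomm (h b hb))
    have hk : 2 ^ k < 2 ^ (k + 1) := Nat.pow_lt_pow_right (by norm_num) (by omega)
    by_cases hB : ∃ d, x.cycleLength d = 2 ^ k
    swap
    · have hiff : ∀ a, x.cycleLength a < 2 ^ (k + 1) ↔ x.cycleLength a < 2 ^ k := fun a =>
        ⟨fun h => hmemS.mp ((hsplit a h).resolve_right fun h' => hB ⟨a, h'⟩), fun h => h.trans hk⟩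
      simp only [hiff]
      exact ih.imp id fun ⟨j, hj, h⟩ => ⟨j, by omega, h⟩
    obtain ⟨d, hd⟩ := hB
    have hDS : ∀ e, x.cycleLength e = 2 ^ k → _root_.Disjoint S (x.cycleFinset e) := by
      intro e he
      rw [Finset.disjoint_left]
      intro a ha h
      rw [hmemS, ← (mem_cycleFinset.mp h).cycleLength_eq, he] at ha
      exact lt_irrefl _ ha
    by_cases hone : ∀ e, x.cycleLength e = 2 ^ k → x.SameCycle d e
    · -- a single cycle of length `2 ^ k`
      have hunion : (Finset.univ.filter fun c => x.cycleLength c < 2 ^ (k + 1)) =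
          S ∪ x.cycleFinset d := by
        ext a
        simp only [Finset.mem_filter, Finset.mem_univ, true_and, Finset.mem_union,
          mem_cycleFinset]
        refine ⟨fun h => (hsplit a h).imp id (hone a), ?_⟩
        rintro (h | h)
        · exact (hmemS.mp h).trans hk
        · rwa [← h.cycleLength_eq, hd]
      have hcard : (Finset.univ.filter fun c => x.cycleLength c < 2 ^ (k + 1)).card =
          S.card + 2 ^ k := by
        rw [hunion, Finset.card_union_of_disjoint (hDS d hd), ← hd]
        rfl
      rcases S.eq_empty_or_nonempty with hSe | ⟨s, hs⟩
      · right
        exact ⟨k, by omega, by rw [hcard, hSe]; simp⟩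
      have hge : 2 ^ k ≤ S.card := by
        have := H d s (by rw [hd]; exact hmemS.mp hs)
        rwa [hd] at this
      -- With exactly `2 ^ k` shorter points no point is left over outside `B`, and the total is `2
      -- ^ (k + 1)`. Otherwise the count exceeds `2 ^ k`, which excludes the second alternative of
      -- `ih`.
      rcases hge.eq_or_lt with heq | hlt
      · right
        exact ⟨k + 1, le_rfl, by rw [hcard, ← heq, pow_succ, mul_two]⟩
      left
      have hSU : ∀ a ∈ S, ∀ b ∈ S, swap a b ∈ U := by
        rcases ih with h | ⟨j, hj, h⟩
        · exact fun a ha b hb => h a b (hmemS.mp ha) (hmemS.mp hb)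
        · have := Nat.pow_le_pow_right (by norm_num : 0 < 2) hj
          omega
      obtain ⟨B, hBS, hBc, hBcard⟩ :=
        hSc.exists_subset_card_eq_two_pow hx (fun a ha => (hmemS.mp ha).le) hge
      obtain ⟨s₀, hs₀, hs₀B⟩ : ∃ s ∈ S, s ∉ B :=
        Finset.exists_mem_notMem_of_card_lt_card (by omega)
      obtain ⟨τ, hτ, hτB, hτD, hτR⟩ := exists_mem_subnormalizer_exchanging hx hBc
        (isCycleClosed_cycleFinset d) ((hDS d hd).mono_left hBS) (by rw [hBcard, ← hd]; rfl)
      -- The spare point `s₀` is fixed by `τ`, so conjugating by `τ⁻¹` carries transpositions `swap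
      -- b s₀` with `b ∈ B` to ones linking the long cycle to `s₀`.
      refine hstar s₀ fun a ha => ?_
      rcases hsplit a ha with h | h
      · exact hSU a h s₀ hs₀
      · have h₁ := hSU _ (hBS (hτD a (mem_cycleFinset.mpr (hone a h)))) s₀ hs₀
        have h₂ := swap_apply_mem (inv_mem hτ) h₁
        have h₃ : τ⁻¹ s₀ = s₀ := by
          rw [inv_eq_iff_eq, hτR s₀ hs₀B (Finset.disjoint_left.mp (hDS d hd) hs₀)]
        rwa [h₃, ← mul_apply, inv_mul_cancel, one_apply] at h₂
    · -- several cycles of length `2 ^ k`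
      left
      push Not at hone
      obtain ⟨e, he, hde⟩ := hone
      have hBU : ∀ a, x.cycleLength a = 2 ^ k → swap a d ∈ U := by
        have hed : swap e d ∈ U :=
          swap_mem_subnormalizer hx (by rw [he, hd]) fun h => hde h.symm
        intro a ha
        -- Points of one cycle are linked through the second cycle, that of `e`.
        by_cases h : x.SameCycle a d
        · have hae : swap a e ∈ U :=
            swap_mem_subnormalizer hx (by rw [ha, he]) fun h' => hde (h.symm.trans h')
          exact htrans hae hed
        · exact swap_mem_subnormalizer hx (by rw [ha, hd]) h
      rcases S.eq_empty_or_nonempty with hSe | ⟨s, hs⟩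
      · refine hstar d fun a ha => hBU a ((hsplit a ha).resolve_left ?_)
        simp [hSe]
      have hge : 2 ^ k ≤ S.card := by
        have := H d s (by rw [hd]; exact hmemS.mp hs)
        rwa [hd] at this
      obtain ⟨B, hBS, hBc, hBcard⟩ :=
        hSc.exists_subset_card_eq_two_pow hx (fun a ha => (hmemS.mp ha).le) hge
      obtain ⟨τ, hτ, hτB, hτD, hτR⟩ := exists_mem_subnormalizer_exchanging hx hBc
        (isCycleClosed_cycleFinset e) ((hDS e he).mono_left hBS) (by rw [hBcard, ← he]; rfl)
      have hBd : ∀ b ∈ B, swap b d ∈ U := by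
        intro b hb
        have h₁ : x.SameCycle e (τ b) := mem_cycleFinset.mp (hτB b hb)
        have h₂ := swap_apply_mem (inv_mem hτ) (hBU (τ b) (by rw [← h₁.cycleLength_eq, he]))
        have h₃ : τ⁻¹ d = d := by
          rw [inv_eq_iff_eq, hτR d (fun h => ?_) (fun h => hde (mem_cycleFinset.mp h).symm)]
          exact Finset.disjoint_left.mp (hDS d hd) (hBS h) (self_mem_cycleFinset d)
        rwa [h₃, ← mul_apply, inv_mul_cancel, one_apply] at h₂
      refine hstar d fun a ha => ?_
      rcases hsplit a ha with h | h
      · by_cases haB : a ∈ B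
        · exact hBd a haB
        obtain ⟨b, hb⟩ : B.Nonempty := Finset.card_pos.mp (by rw [hBcard]; positivity)
        -- A point of `S` outside `B` forces more than `2 ^ k` points in `S`, so `ih` must give
        -- transpositions.
        have hlt : B.card < S.card := Finset.card_lt_card ⟨hBS, fun h' => haB (h' h)⟩
        rcases ih with h' | ⟨j, hj, h'⟩
        · exact htrans (h' a b (hmemS.mp h) (hmemS.mp (hBS hb))) (hBd b hb)
        · have := Nat.pow_le_pow_right (by norm_num : 0 < 2) hj
          omega
      · exact hBU a h

theorem subnormalizer_eq_top (hx : IsPGroup 2 (Subgroup.zpowers x))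
    (hcard : ¬ ∃ a, Fintype.card α = 2 ^ a)
    (H : ∀ a b, x.cycleLength b < x.cycleLength a →
      x.cycleLength a ≤ (Finset.univ.filter fun c => x.cycleLength c < x.cycleLength a).card) :
    subnormalizer x = ⊤ := by
  have hlt : ∀ a, x.cycleLength a < 2 ^ Fintype.card α := fun a =>
    (Finset.card_le_univ _).trans_lt Nat.lt_two_pow_self
  rw [eq_top_iff, ← closure_isSwap, Subgroup.closure_le]
  rintro _ ⟨a, b, -, rfl⟩
  -- This bound exceeds every cycle length, so all points are covered and the exceptional case
  -- contradicts `hcard`.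
  rcases swap_mem_subnormalizer_or_card_eq hx H (Fintype.card α) with h | ⟨j, -, h⟩
  · exact h a b (hlt a) (hlt b)
  · rw [Finset.filter_true_of_mem fun a _ => hlt a, Finset.card_univ] at h
    exact absurd ⟨j, h⟩ hcard

end Equiv.Perm

/-! ### Long and short cycles, and the decomposition. -/

namespace Equiv.Perm

variable {α : Type*}

theorem mem_range_subtypeCongrHom {p : α → Prop} [DecidablePred p] {g : Perm α}
    (h : ∀ a, p (g a) ↔ p a) : g ∈ (subtypeCongrHom p).range := by
  refine ⟨(g.subtypePerm h, g.subtypePerm fun a => not_congr (h a)), ?_⟩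
  ext a
  rw [subtypeCongrHom_apply]
  by_cases ha : p a
  · rw [Perm.subtypeCongr.left_apply _ _ ha]
    rfl
  · rw [Perm.subtypeCongr.right_apply _ _ ha]
    rfl

variable [DecidableEq α]

theorem range_subtypeCongrHom_ne_top {p : α → Prop} [DecidablePred p] {a b : α} (ha : p a)
    (hb : ¬ p b) : (subtypeCongrHom p).range ≠ ⊤ := by
  intro h
  obtain ⟨⟨u, v⟩, huv⟩ : swap a b ∈ (subtypeCongrHom p).range := h ▸ Subgroup.mem_top _
  have h' := congrArg (fun g : Perm α => g a) huv
  simp only [subtypeCongrHom_apply, swap_apply_left] at h'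
  rw [Perm.subtypeCongr.left_apply _ _ ha] at h'
  exact hb (h' ▸ (u ⟨a, ha⟩).2)

variable [Fintype α] {x : Perm α}

theorem cycleFinset_eq_support {c : Perm α} (hc : c ∈ x.cycleFactorsFinset) {a : α}
    (ha : a ∈ c.support) : x.cycleFinset a = c.support := by
  have hxa : x a ≠ a := mem_support.mp (mem_cycleFactorsFinset_support_le hc ha)
  ext b
  rw [mem_cycleFinset, cycle_is_cycleOf ha hc, mem_support_cycleOf_iff' hxa]

theorem cycleLength_eq_card_support {c : Perm α} (hc : c ∈ x.cycleFactorsFinset) {a : α}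
    (ha : a ∈ c.support) : x.cycleLength a = c.support.card := by
  rw [cycleLength, cycleFinset_eq_support hc ha]

theorem cycleLength_eq_one_iff {a : α} : x.cycleLength a = 1 ↔ x a = a := by
  rw [← Nat.dvd_one, ← Int.natCast_dvd_natCast, Nat.cast_one, ← zpow_apply_eq_self_iff, zpow_one]

theorem biUnion_support_filter (x : Perm α) (p : ℕ → Prop) [DecidablePred p] :
    ((x.cycleFactorsFinset.filter fun c => p c.support.card).biUnion fun c => c.support) =
      x.support.filter fun a => p (x.cycleLength a) := by
  ext a
  simp only [Finset.mem_biUnion, Finset.mem_filter]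
  constructor
  · rintro ⟨c, ⟨hc, hp⟩, ha⟩
    exact ⟨mem_cycleFactorsFinset_support_le hc ha, by rwa [cycleLength_eq_card_support hc ha]⟩
  · rintro ⟨ha, hp⟩
    have hc := cycleOf_mem_cycleFactorsFinset_iff.mpr ha
    have hac : a ∈ (x.cycleOf a).support :=
      (mem_support_cycleOf_iff' (mem_support.mp ha)).mpr (.refl x a)
    exact ⟨x.cycleOf a, ⟨hc, by rwa [← cycleLength_eq_card_support hc hac]⟩, hac⟩

/-- Moved points are counted cycle by cycle; fixed points are absent from the cycle factors and
match the parts 1 appended in `partition`. -/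
theorem card_filter_cycleLength (x : Perm α) (p : ℕ → Prop) [DecidablePred p] :
    (Finset.univ.filter fun a => p (x.cycleLength a)).card =
      (x.partition.parts.filter p).sum := by
  rw [parts_partition, Multiset.filter_add, Multiset.sum_add,
    ← Finset.card_filter_add_card_filter_not (s := Finset.univ.filter _) (fun a => a ∈ x.support)]
  congr 1
  · have h : (Finset.univ.filter fun a => p (x.cycleLength a)).filter (fun a => a ∈ x.support) =
        x.support.filter fun a => p (x.cycleLength a) := by
      ext a
      simp [and_comm]
    rw [h, ← biUnion_support_filter, Finset.card_biUnion, cycleType_def, Multiset.filter_map]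
    · rfl
    · intro c hc d hd hcd
      rw [Finset.mem_coe, Finset.mem_filter] at hc hd
      exact (x.cycleFactorsFinset_pairwise_disjoint hc.1 hd.1 hcd).disjoint_support
  · have hfix : ∀ a, a ∉ x.support → x.cycleLength a = 1 := fun a ha =>
      cycleLength_eq_one_iff.mpr (notMem_support.mp ha)
    by_cases h1 : p 1
    · have h : (Finset.univ.filter fun a => p (x.cycleLength a)).filter
          (fun a => a ∉ x.support) = x.supportᶜ := by
        ext a
        simp only [Finset.mem_filter, Finset.mem_univ, true_and, Finset.mem_compl,
          and_iff_right_iff_imp]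
        intro ha
        rwa [hfix a ha]
      rw [h, Finset.card_compl, Multiset.filter_eq_self.mpr]
      · simp
      · intro b hb
        rwa [Multiset.eq_of_mem_replicate hb]
    · rw [Finset.card_eq_zero.mpr, Multiset.filter_eq_nil.mpr]
      · simp
      · intro b hb
        rwa [Multiset.eq_of_mem_replicate hb]
      · rw [Finset.filter_eq_empty_iff]
        intro a ha hs
        rw [Finset.mem_filter, hfix a hs] at ha
        exact h1 ha.2

/-- The bound on `L` is needed because fixed points have cycle length 1 but never lie in the
support. -/
theorem support_longPart (x : Perm α) {L : ℕ} (hL : 2 ≤ L) :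
    (x.longPart L).support = Finset.univ.filter fun a => L ≤ x.cycleLength a := by
  have hs : Set.Pairwise (x.cycleFactorsFinset.filter fun c => L ≤ c.support.card : Set (Perm α))
      fun c d => Disjoint (id c) (id d) := fun c hc d hd h =>
    x.cycleFactorsFinset_pairwise_disjoint (Finset.mem_filter.mp hc).1
      (Finset.mem_filter.mp hd).1 h
  refine (support_noncommProd hs).trans ((x.biUnion_support_filter (L ≤ ·)).trans ?_)
  ext a
  simp only [Finset.mem_filter, Finset.mem_univ, true_and, and_iff_right_iff_imp]
  intro h
  rw [mem_support, ne_eq, ← cycleLength_eq_one_iff]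
  omega

theorem longPart_mul_shortPart (x : Perm α) (L : ℕ) : x.longPart L * x.shortPart L = x := by
  conv_rhs => rw [← x.cycleFactorsFinset_noncommProd]
  have hdisj : _root_.Disjoint (x.cycleFactorsFinset.filter fun c => L ≤ c.support.card)
      (x.cycleFactorsFinset.filter fun c => c.support.card < L) := by
    simp only [← not_le]
    exact Finset.disjoint_filter_filter_not _ _ _
  have hunion : (x.cycleFactorsFinset.filter fun c => L ≤ c.support.card) ∪
      (x.cycleFactorsFinset.filter fun c => c.support.card < L) = x.cycleFactorsFinset := by
    simp only [← not_le]
    exact Finset.filter_union_filter_not_eq _ _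
  unfold longPart shortPart
  rw [← Finset.noncommProd_union_of_disjoint hdisj id]
  · exact Finset.noncommProd_congr hunion (fun _ _ => rfl) _
  · rw [hunion]
    exact x.cycleFactorsFinset_mem_commute

theorem subtypeCongrHom_longPart_shortPart (x : Perm α) (L : ℕ) :
    subtypeCongrHom (fun a => a ∈ (x.longPart L).support)
      (x.longPartOnSupport L, x.shortPartOnCompl L) = x := by
  have hd := x.disjoint_longPart_shortPart L
  ext a
  conv_rhs => rw [← x.longPart_mul_shortPart L]
  by_cases ha : a ∈ (x.longPart L).support
  · have : x.shortPart L a = a := (hd a).resolve_left (mem_support.mp ha)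
    simp only [subtypeCongrHom_apply, mul_apply, this]
    rw [Perm.subtypeCongr.left_apply _ _ ha]
    rfl
  · have h : x.shortPart L a ∉ (x.longPart L).support := by
      rwa [shortPart_apply_notMem_support_longPart_iff]
    simp only [subtypeCongrHom_apply, mul_apply, notMem_support.mp h]
    rw [Perm.subtypeCongr.right_apply _ _ ha]
    rfl

/-- If the cycles of a `2`-element `x` of length less than `2 ^ m` have fewer than `2 ^ m` points in
total, then the normalizer of any `2`-subgroup containing `x` leaves the set of points in the other
cycles invariant. -/
theorem two_pow_le_cycleLength_apply_iff {m : ℕ}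
    (hlt : (Finset.univ.filter fun a => x.cycleLength a < 2 ^ m).card < 2 ^ m)
    {Q : Subgroup (Perm α)} (hQ : IsPGroup 2 Q) (hxQ : x ∈ Q) {g : Perm α}
    (hg : g ∈ Subgroup.normalizer (Q : Set (Perm α))) (a : α) :
    2 ^ m ≤ x.cycleLength (g a) ↔ 2 ^ m ≤ x.cycleLength a := by
  classical
  let O : α → Finset α := fun a => Finset.univ.filter fun b => b ∈ MulAction.orbit Q a
  have hmem : ∀ {a b}, b ∈ O a ↔ ∃ q ∈ Q, q a = b := by
    intro a b
    simp only [O, Finset.mem_filter, Finset.mem_univ, true_and]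
    exact ⟨fun ⟨q, hq⟩ => ⟨q, q.2, hq⟩, fun ⟨q, hq, h⟩ => ⟨⟨q, hq⟩, h⟩⟩
  have hclosed : ∀ a, x.IsCycleClosed (O a) := by
    rintro a b hb _ ⟨i, rfl⟩
    rw [hmem] at hb ⊢
    obtain ⟨q, hq, rfl⟩ := hb
    exact ⟨x ^ i * q, mul_mem (zpow_mem hxQ i) hq, rfl⟩
  have hself : ∀ a, a ∈ O a := fun a => hmem.mpr ⟨1, one_mem _, rfl⟩
  have hOpow : ∀ a, ∃ k, (O a).card = 2 ^ k := by
    intro a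
    obtain ⟨k, hk⟩ := hQ.card_orbit a
    refine ⟨k, ?_⟩
    rw [← hk, Nat.card_coe_set_eq, ← Set.ncard_coe_finset]
    congr 1
    ext b
    simp [O]
  have hx : IsPGroup 2 (Subgroup.zpowers x) := hQ.to_le (by simpa using hxQ)
  -- An orbit through a long cycle consists of long cycles.
  have hlong : ∀ a, 2 ^ m ≤ x.cycleLength a → ∀ b ∈ O a, 2 ^ m ≤ x.cycleLength b := by
    intro a ha
    obtain ⟨k, hk⟩ := hOpow a
    have hle : 2 ^ m ≤ (O a).card :=
      ha.trans (Finset.card_le_card ((hclosed a).cycleFinset_subset (hself a)))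
    have hdvd : 2 ^ m ∣ (O a).card := by
      rw [hk] at hle ⊢
      exact pow_dvd_pow 2 ((Nat.pow_le_pow_iff_right (by norm_num)).mp hle)
    have hdvd' : 2 ^ m ∣ (O a ∩ Finset.univ.filter fun b => 2 ^ m ≤ x.cycleLength b).card := by
      refine ((hclosed a).inter (isCycleClosed_filter (2 ^ m ≤ ·))).dvd_card fun b hb => ?_
      have hb' := (Finset.mem_filter.mp (Finset.mem_inter.mp hb).2).2
      obtain ⟨j, hj⟩ := exists_cycleLength_eq_two_pow hx b
      rw [hj] at hb' ⊢
      exact pow_dvd_pow 2 ((Nat.pow_le_pow_iff_right (by norm_num)).mp hb')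
    have hsum : (O a ∩ Finset.univ.filter fun b => 2 ^ m ≤ x.cycleLength b).card +
        ((O a).filter fun b => ¬ 2 ^ m ≤ x.cycleLength b).card = (O a).card := by
      rw [← Finset.card_filter_add_card_filter_not (s := O a) (fun b => 2 ^ m ≤ x.cycleLength b)]
      congr 2
      ext b
      simp
    rw [← hsum] at hdvd
    have hdvd'' := (Nat.dvd_add_right hdvd').mp hdvd
    have hshort : ((O a).filter fun b => ¬ 2 ^ m ≤ x.cycleLength b).card < 2 ^ m := by
      refine (Finset.card_le_card fun b hb => ?_).trans_lt hlt
      simpa using (Finset.mem_filter.mp hb).2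
    have hempty := Finset.card_eq_zero.mp (Nat.eq_zero_of_dvd_of_lt hdvd'' hshort)
    intro b hb
    by_contra hb'
    exact Finset.notMem_empty b (hempty ▸ Finset.mem_filter.mpr ⟨hb, hb'⟩)
  -- Long points are now described by orbit sizes alone, which `g` preserves since it permutes the
  -- `Q`-orbits.
  have hOcard : ∀ a, 2 ^ m ≤ (O a).card ↔ 2 ^ m ≤ x.cycleLength a := by
    intro a
    constructor
    · intro h
      by_contra ha
      refine absurd (h.trans (Finset.card_le_card fun b hb => ?_)) (not_le.mpr hlt)
      rw [Finset.mem_filter]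
      refine ⟨Finset.mem_univ _, not_le.mp fun hb' => ha (hlong b hb' a ?_)⟩
      obtain ⟨q, hq, rfl⟩ := hmem.mp hb
      exact hmem.mpr ⟨q⁻¹, inv_mem hq, by simp⟩
    · exact fun h => h.trans
        (Finset.card_le_card ((hclosed a).cycleFinset_subset (hself a)))
  have hmap : O (g a) = (O a).map g.toEmbedding := by
    ext b
    simp only [Finset.mem_map_equiv, hmem]
    rw [Subgroup.mem_normalizer_iff] at hg
    constructor
    · rintro ⟨q, hq, rfl⟩
      refine ⟨g⁻¹ * q * g, ?_, rfl⟩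
      rw [hg]
      simpa [mul_assoc] using hq
    · rintro ⟨q, hq, h⟩
      refine ⟨g * q * g⁻¹, (hg q).mp hq, ?_⟩
      simp [h]
  rw [← hOcard, ← hOcard, hmap, Finset.card_map]

/-- The subnormalizer of a `2`-element decomposes along the sets of points in long and in short
cycles, if the short cycles have few points in total. -/
theorem subnormalizer_eq_map_prod (hx : IsPGroup 2 (Subgroup.zpowers x)) {m : ℕ} (hm : 1 ≤ m)
    (hlt : (Finset.univ.filter fun a => x.cycleLength a < 2 ^ m).card < 2 ^ m) :
    subnormalizer x =
      ((subnormalizer (x.longPartOnSupport (2 ^ m))).prod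
        (subnormalizer (x.shortPartOnCompl (2 ^ m)))).map
        (subtypeCongrHom fun a => a ∈ (x.longPart (2 ^ m)).support) := by
  set y := x.longPartOnSupport (2 ^ m) with hy
  set z := x.shortPartOnCompl (2 ^ m) with hz
  set φ := subtypeCongrHom fun a => a ∈ (x.longPart (2 ^ m)).support with hφ
  have hφinj : Function.Injective φ := subtypeCongrHom_injective _
  have hxyz : φ (y, z) = x := x.subtypeCongrHom_longPart_shortPart (2 ^ m)
  have hyz : IsPGroup 2 (Subgroup.zpowers (y, z)) := by
    refine (hx.comap_of_injective φ hφinj).to_le ?_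
    rw [Subgroup.zpowers_le, Subgroup.mem_comap, hxyz]
    exact Subgroup.mem_zpowers x
  have hyp : IsPGroup 2 (Subgroup.zpowers y) := by
    have := hyz.map (MonoidHom.fst _ _)
    rwa [MonoidHom.map_zpowers] at this
  have hzp : IsPGroup 2 (Subgroup.zpowers z) := by
    have := hyz.map (MonoidHom.snd _ _)
    rwa [MonoidHom.map_zpowers] at this
  have hL : 2 ≤ 2 ^ m := Nat.le_self_pow (by omega) 2
  have hrange : ∀ Q : Subgroup (Perm α), IsPGroup 2 Q → φ (y, z) ∈ Q →
      Subgroup.normalizer (Q : Set (Perm α)) ≤ φ.range := by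
    intro Q hQ hxQ g hg
    rw [hxyz] at hxQ
    refine mem_range_subtypeCongrHom fun a => ?_
    simpa [support_longPart x hL] using two_pow_le_cycleLength_apply_iff hlt hQ hxQ hg a
  rw [← hxyz] at hx
  conv_lhs => rw [← hxyz]
  exact le_antisymm (subnormalizer_le_map_prod hφinj hx hrange)
    (map_prod_subnormalizer_le φ hyp hzp)

end Equiv.Perm

/-! ### Translation to the cycle type and conclusion. -/

theorem Multiset.sum_filter_sum_replicate {ι : Type*} (s : Finset ι) (k c : ι → ℕ) (p : ℕ → Prop)
    [DecidablePred p] :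
    ((∑ i ∈ s, Multiset.replicate (k i) (c i)).filter p).sum =
      ∑ i ∈ s with p (c i), k i * c i := by
  classical
  induction s using Finset.induction_on with
  | empty => simp
  | insert i s hi ih =>
    rw [Finset.sum_insert hi, Multiset.filter_add, Multiset.sum_add, ih, Finset.filter_insert]
    split_ifs with h
    · rw [Finset.sum_insert (by simp [hi]), Multiset.filter_eq_self.mpr]
      · simp
      · intro b hb
        rwa [Multiset.eq_of_mem_replicate hb]
    · rw [Multiset.filter_eq_nil.mpr]
      · simp
      · intro b hb
        rwa [Multiset.eq_of_mem_replicate hb]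

theorem mainTheorem4 (n : ℕ) (hn : ¬ ∃ a : ℕ, n = 2 ^ a)
    (x : Equiv.Perm (Fin n)) (hx : ∃ a : ℕ, orderOf x = 2 ^ a)
    (r : ℕ) (m ℓ : Fin r → ℕ) (hm : StrictMono m) (hℓ : ∀ i, 1 ≤ ℓ i)
    (hcycles : x.partition.parts = ∑ i, Multiset.replicate (ℓ i) (2 ^ m i)) :
    (subnormalizer x < ⊤ ↔
      ∃ t : Fin r, 0 < t.val ∧ ∑ i ∈ Finset.Iio t, ℓ i * 2 ^ m i < 2 ^ m t) ∧
    ∀ t : Fin r, 0 < t.val → ∑ i ∈ Finset.Iio t, ℓ i * 2 ^ m i < 2 ^ m t →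
      (x.longPart (2 ^ m t)).support.card = ∑ i ∈ Finset.Ici t, ℓ i * 2 ^ m i ∧
      subnormalizer x =
        ((subnormalizer (x.longPartOnSupport (2 ^ m t))).prod
          (subnormalizer (x.shortPartOnCompl (2 ^ m t)))).map
          (Equiv.Perm.subtypeCongrHom fun a => a ∈ (x.longPart (2 ^ m t)).support) := by
  have hxp : IsPGroup 2 (Subgroup.zpowers x) :=
    hx.elim fun a ha => isPGroup_zpowers_of_orderOf_eq ha
  have hcount (p : ℕ → Prop) [DecidablePred p] :
      (Finset.univ.filter fun a => p (x.cycleLength a)).card =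
        ∑ i with p (2 ^ m i), ℓ i * 2 ^ m i := by
    rw [x.card_filter_cycleLength, hcycles, Multiset.sum_filter_sum_replicate]
  have hpow : StrictMono fun i => 2 ^ m i := fun i j h =>
    Nat.pow_lt_pow_right (by norm_num) (hm h)
  have hshort (t : Fin r) : (Finset.univ.filter fun a => x.cycleLength a < 2 ^ m t).card =
      ∑ i ∈ Finset.Iio t, ℓ i * 2 ^ m i := by
    rw [hcount (· < 2 ^ m t)]
    refine Finset.sum_congr ?_ fun _ _ => rfl
    ext i
    simpa using hpow.lt_iff_lt
  have hlong (t : Fin r) : (Finset.univ.filter fun a => 2 ^ m t ≤ x.cycleLength a).card =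
      ∑ i ∈ Finset.Ici t, ℓ i * 2 ^ m i := by
    rw [hcount (2 ^ m t ≤ ·)]
    refine Finset.sum_congr ?_ fun _ _ => rfl
    ext i
    simpa using hpow.le_iff_le
  have hlength (a : Fin n) : ∃ i, x.cycleLength a = 2 ^ m i := by
    by_contra hno
    have h := hcount (· = x.cycleLength a)
    rw [Finset.filter_false_of_mem (s := (Finset.univ : Finset (Fin r)))
      fun i _ hi => hno ⟨i, hi.symm⟩, Finset.sum_empty, Finset.card_eq_zero] at h
    exact Finset.notMem_empty a (h ▸ Finset.mem_filter.mpr ⟨Finset.mem_univ _, rfl⟩)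
  have hpoint (i : Fin r) : ∃ a, x.cycleLength a = 2 ^ m i := by
    have h : 0 < (Finset.univ.filter fun a => x.cycleLength a = 2 ^ m i).card := by
      rw [hcount (· = 2 ^ m i)]
      exact Finset.sum_pos (fun j _ => Nat.mul_pos (hℓ j) (by positivity)) ⟨i, by simp⟩
    obtain ⟨a, ha⟩ := Finset.card_pos.mp h
    exact ⟨a, (Finset.mem_filter.mp ha).2⟩
  have hmt (t : Fin r) (ht : 0 < t.val) : 1 ≤ m t :=
    Nat.one_le_iff_ne_zero.mpr (Nat.ne_zero_of_lt (hm (a := ⟨0, ht.trans t.2⟩) ht))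
  have htwo (t : Fin r) (ht : 0 < t.val) : 2 ≤ 2 ^ m t :=
    Nat.le_self_pow (Nat.one_le_iff_ne_zero.mp (hmt t ht)) 2
  have hdecomp (t : Fin r) (ht : 0 < t.val) (hlt : ∑ i ∈ Finset.Iio t, ℓ i * 2 ^ m i < 2 ^ m t) :=
    Equiv.Perm.subnormalizer_eq_map_prod hxp (hmt t ht) (by rwa [hshort])
  refine ⟨⟨fun hlt => ?_, ?_⟩, fun t ht hlt => ⟨?_, hdecomp t ht hlt⟩⟩
  · by_contra! hno
    refine hlt.ne (Equiv.Perm.subnormalizer_eq_top hxp (by simpa using hn) fun a b hab => ?_)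
    obtain ⟨t, ht⟩ := hlength a
    obtain ⟨s, hs⟩ := hlength b
    rw [ht, hs] at hab
    rw [ht, hshort]
    exact hno t (Nat.zero_lt_of_lt (hpow.lt_iff_lt.mp hab))
  · rintro ⟨t, ht, hlt⟩
    obtain ⟨a, ha⟩ := hpoint t
    obtain ⟨b, hb⟩ := hpoint ⟨0, ht.trans t.2⟩
    rw [hdecomp t ht hlt]
    -- The range is proper because both blocks are nonempty: `a` lies in a cycle of length `2 ^ m
    -- t`, `b` in a shortest cycle.
    refine lt_of_le_of_lt (Subgroup.map_le_range _ _) (lt_top_iff_ne_top.mpr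
      (Equiv.Perm.range_subtypeCongrHom_ne_top (a := a) (b := b) ?_ ?_))
    · rw [x.support_longPart (htwo t ht), Finset.mem_filter]
      exact ⟨Finset.mem_univ _, ha.ge⟩
    · rw [x.support_longPart (htwo t ht), Finset.mem_filter, hb, not_and, not_le]
      exact fun _ => hpow (show (⟨0, ht.trans t.2⟩ : Fin r) < t from ht)
  · rw [x.support_longPart (htwo t ht), hlong]
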